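/- Let $\mathcal H=\mathcal H_S\otimes\mathcal H_B$ with $\mathcal H_S=\mathbb C^{d_S}$, $\mathcal H_B=\mathbb C^{d_B}$, and let $d=d_Sd_B$. Let $H$ be a random Hamiltonian on $\mathcal H$, i.e. a random Hermitian operator on $\mathcal H$ whose eigenvectors are $|E_k\rangle=U|b_k\rangle$, $k=1,\dots,d$, where $(|b_k\rangle)$ is some fixed orthonormal basis of $\mathcal H$ and $U$ is distributed according to the normalized Haar measure of the unitary group $U(d)$. The eigenvalues $E_k\in\mathbb R$ may be random and may depend on $U$ in any way, subject only to having almost surely non-degenerate gaps: $E_k-E_l=E_m-E_n$ implies ($k=l$ and $m=n$) or ($k=m$ and $l=n$). (In particular the spectrum is then simple and the $|E_k\rangle$ are, up to phases, all the normalized eigenvectors of $H$.) For matrices $\rho,\sigma$ let $\mathcal D(\rho,\sigma)=\tfrac12\operatorname{Tr}|\rho-\sigma|$, with $|A|=\sqrt{A^\dagger A}$, be the trace distance, and let $\operatorname{Tr}_B$ be the partial trace over $\mathcal H_B$. Then for every $\epsilon>0$ $$\Pr\Big\{\exists\,|\psi\rangle \text{ a normalized eigenvector of } H:\ \mathcal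 D\Big(\operatorname{Tr}_B|\psi\rangle\langle\psi|,\frac{\mathbb 1}{d_S}\Big)\ge\epsilon\Big\}\ \le\ 2\,d\,\Big(\frac{10\,d_S}{\epsilon}\Big)^{2d_S}e^{-C\,d_B\,\epsilon^2},\qquad C=(14\ln 2)^{-1}.$$ -/

import Mathlib

open MeasureTheory ProbabilityTheory Matrix
open scoped MatrixOrder

noncomputable section

namespace RandomHamiltonian

/-- The Borel σ-algebra of the unitary group `U(n)`. -/
instance unitaryMeasurableSpace (n : Type*) [Fintype n] [DecidableEq n] :
    MeasurableSpace (unitaryGroup n ℂ) := borel _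

instance unitaryBorelSpace (n : Type*) [Fintype n] [DecidableEq n] :
    BorelSpace (unitaryGroup n ℂ) := ⟨rfl⟩

theorem isCompact_unitaryGroup (n : Type*) [Fintype n] [DecidableEq n] :
    IsCompact (unitaryGroup n ℂ : Set (Matrix n n ℂ)) := by
  have hcl : IsClosed (unitaryGroup n ℂ : Set (Matrix n n ℂ)) := by
    have h : (unitaryGroup n ℂ : Set (Matrix n n ℂ)) = {A | A * star A = 1} := by
      ext A
      exact mem_unitaryGroup_iff
    rw [h]
    exact isClosed_eq (by fun_prop) continuous_const
  have hsub : (unitaryGroup n ℂ : Set (Matrix n n ℂ)) ⊆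
      Set.univ.pi fun _ : n => Set.univ.pi fun _ : n => Metric.closedBall (0 : ℂ) 1 := by
    intro A hA i _ j _
    simpa using entry_norm_bound_of_unitary hA i j
  exact IsCompact.of_isClosed_subset
    (isCompact_univ_pi fun _ => isCompact_univ_pi fun _ => isCompact_closedBall _ _) hcl hsub

instance unitaryCompactSpace (n : Type*) [Fintype n] [DecidableEq n] :
    CompactSpace (unitaryGroup n ℂ) :=
  isCompact_iff_compactSpace.mp (isCompact_unitaryGroup n)

/-- The Haar measure of the compact group `U(n)`, normalized to total mass one. -/
def haarUnitary (n : Type*) [Fintype n] [DecidableEq n] : Measure (unitaryGroup n ℂ) :=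
  Measure.haarMeasure ⊤

instance haarUnitary_isHaarMeasure (n : Type*) [Fintype n] [DecidableEq n] :
    (haarUnitary n).IsHaarMeasure := by
  unfold haarUnitary
  infer_instance

instance haarUnitary_isProbabilityMeasure (n : Type*) [Fintype n] [DecidableEq n] :
    IsProbabilityMeasure (haarUnitary n) :=
  ⟨by simpa [haarUnitary] using
    Measure.haarMeasure_self (K₀ := (⊤ : TopologicalSpace.PositiveCompacts (unitaryGroup n ℂ)))⟩

/-- The density matrix `|ψ⟩⟨ψ|`. -/
def ketbra {n : Type*} (ψ : EuclideanSpace ℂ n) : Matrix n n ℂ :=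
  vecMulVec ψ (star ψ)

/-- The partial trace over the second tensor factor: `⟨i| Tr_B ρ |j⟩ = ∑ₖ ⟨i,k| ρ |j,k⟩`. -/
def partialTraceB {s b : Type*} [Fintype b] (ρ : Matrix (s × b) (s × b) ℂ) : Matrix s s ℂ :=
  fun i j => ∑ k, ρ (i, k) (j, k)

/-- The trace distance `½ Tr |ρ - σ|`, where `|A| = √(A† A)`. -/
def traceDistance {n : Type*} [Fintype n] [DecidableEq n] (ρ σ : Matrix n n ℂ) : ℝ :=
  (1 / 2) * (CFC.abs (ρ - σ)).trace.re

/-- Non-degenerate energy gaps. In particular the energies `E k` are pairwise distinct. -/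
def NondegenerateGaps {n : Type*} (E : n → ℝ) : Prop :=
  ∀ k l m r, E k - E l = E m - E r → (k = l ∧ m = r) ∨ (k = m ∧ l = r)

/-- `H` is a random Hamiltonian: a random Hermitian matrix which almost surely has non-degenerate
energy gaps and whose eigenbasis is `U b₁, …, U b_d`, where `b` is some fixed orthonormal basis and
`U` is a Haar distributed unitary. The energies `E` may depend on `U` in any way. -/
def IsRandomHamiltonian {n Ω : Type*} [Fintype n] [DecidableEq n] [MeasurableSpace Ω]
    (P : Measure Ω) (H : Ω → Matrix n n ℂ) : Prop :=
  ∃ (b : OrthonormalBasis n ℂ (EuclideanSpace ℂ n)) (U : Ω → unitaryGroup n ℂ) (E : Ω → n → ℝ),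
    HasLaw U (haarUnitary n) P ∧
    ∀ᵐ ω ∂P, (H ω).IsHermitian ∧ NondegenerateGaps (E ω) ∧
      ∀ k, Module.End.HasEigenvector (toEuclideanLin (H ω)) (E ω k : ℂ)
        (toEuclideanLin (U ω : Matrix n n ℂ) (b k))

/-- `ψ` is a normalized eigenvector of `H`. -/
def IsEigenstate {n : Type*} [Fintype n] [DecidableEq n] (H : Matrix n n ℂ)
    (ψ : EuclideanSpace ℂ n) : Prop :=
  ‖ψ‖ = 1 ∧ ∃ e : ℂ, Module.End.HasEigenvector (toEuclideanLin H) e ψ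

end RandomHamiltonian

end

/-! Non-degenerate gaps make the spectrum simple, so up to phase every eigenvector is one of the `d`
vectors `U bₖ`, and a union bound reduces the claim to a single Haar random unit vector `ψ`.

Only a lower tail is needed. The reduced state minus `1/d_S` has trace zero, so trace distance at
least `ε` forces an eigenvalue at most `-ε/d_S`: some unit `φ` satisfies `d_S ‖⟨φ|ψ⟩‖² ≤ 1 - ε`.

For fixed `φ` this is a concentration estimate, obtained from volumes
(`volume_deficientCone_inter_ball_le`). The vectors deficient along `φ` form a cone, and a linear
map of large determinant does not increase norms on it, so the cone fills a small part of the unit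
ball. Fubini turns this fraction into a Haar probability (`haarUnitary_apply_mem_mul_volume_ball`).

Uniformity in `φ` comes from averaging in place of a net (`haarUnitary_mem_deficientVectors_le`).
One bad `φ` makes a whole ball of nearby `χ` bad with deficiency `ε/2`. Markov's inequality for the
volume of bad `χ` then costs only a ratio of ball volumes. -/

noncomputable section

namespace RandomHamiltonian

open scoped Kronecker

/-! ### Partial inner products and the reduced state -/

section PartialInner

variable {s b : Type*}

/-- The vector `(z (i, k))ᵢ` of the first tensor factor. -/
def slice (z : EuclideanSpace ℂ (s × b)) (k : b) : EuclideanSpace ℂ s :=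
  WithLp.toLp 2 fun i => z (i, k)

theorem slice_smul (c : ℂ) (z : EuclideanSpace ℂ (s × b)) (k : b) :
    slice (c • z) k = c • slice z k := rfl

variable [Fintype s]

/-- The partial inner product `(⟨φ| ⊗ 1) z`, a vector of the second tensor factor. -/
def partialInner (φ : EuclideanSpace ℂ s) (z : EuclideanSpace ℂ (s × b)) : EuclideanSpace ℂ b :=
  WithLp.toLp 2 fun k => inner ℂ φ (slice z k)

theorem partialInner_apply (φ : EuclideanSpace ℂ s) (z : EuclideanSpace ℂ (s × b)) (k : b) :
    partialInner φ z k = inner ℂ φ (slice z k) := rfl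

theorem partialInner_sub (φ χ : EuclideanSpace ℂ s) (z : EuclideanSpace ℂ (s × b)) :
    partialInner (φ - χ) z = partialInner φ z - partialInner χ z := by
  ext k
  simp [partialInner_apply]

theorem partialInner_smul_left (c : ℂ) (φ : EuclideanSpace ℂ s) (z : EuclideanSpace ℂ (s × b)) :
    partialInner (c • φ) z = star c • partialInner φ z := by
  ext k
  simp [partialInner_apply, mul_comm]

theorem partialInner_smul_right (c : ℂ) (φ : EuclideanSpace ℂ s) (z : EuclideanSpace ℂ (s × b)) :
    partialInner φ (c • z) = c • partialInner φ z := by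
  ext k
  simp [partialInner_apply, slice_smul]

theorem continuous_partialInner :
    Continuous fun p : EuclideanSpace ℂ s × EuclideanSpace ℂ (s × b) => partialInner p.1 p.2 := by
  unfold partialInner slice
  fun_prop

variable [Fintype b]

theorem sum_norm_sq_slice (z : EuclideanSpace ℂ (s × b)) :
    ∑ k, ‖slice z k‖ ^ 2 = ‖z‖ ^ 2 := by
  simp only [EuclideanSpace.norm_sq_eq, Fintype.sum_prod_type]
  rw [Finset.sum_comm]
  rfl

theorem norm_partialInner_le (φ : EuclideanSpace ℂ s) (z : EuclideanSpace ℂ (s × b)) :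
    ‖partialInner φ z‖ ≤ ‖φ‖ * ‖z‖ := by
  refine le_of_sq_le_sq ?_ (by positivity)
  rw [mul_pow, ← sum_norm_sq_slice, EuclideanSpace.norm_sq_eq, Finset.mul_sum]
  refine Finset.sum_le_sum fun k _ => ?_
  rw [← mul_pow]
  exact pow_le_pow_left₀ (norm_nonneg _) (norm_inner_le_norm _ _) 2

theorem star_dotProduct_partialTraceB_mulVec (φ : EuclideanSpace ℂ s)
    (ψ : EuclideanSpace ℂ (s × b)) :
    star φ.ofLp ⬝ᵥ partialTraceB (ketbra ψ) *ᵥ φ.ofLp = ((‖partialInner φ ψ‖ ^ 2 : ℝ) : ℂ) := by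
  rw [EuclideanSpace.norm_sq_eq]
  simp only [dotProduct, mulVec, partialTraceB, ketbra, vecMulVec_apply, Pi.star_apply]
  push_cast
  simp only [partialInner_apply, ← Complex.mul_conj', PiLp.inner_apply, slice, map_sum,
    RCLike.inner_apply, map_mul, Complex.conj_conj, Finset.sum_mul, Finset.mul_sum]
  simp only [Finset.sum_comm (s := (Finset.univ : Finset b))]
  rw [Finset.sum_comm]
  refine Finset.sum_congr rfl fun i _ => Finset.sum_congr rfl fun j _ =>
    Finset.sum_congr rfl fun k _ => ?_
  simp only [RCLike.star_def]
  ring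

end PartialInner

/-! ### Volume of a deficient cone by anisotropic scaling -/

section Scaling

variable {s b : Type*} [Fintype s] [DecidableEq s]

/-- The matrix that scales the line of the unit vector `φ` by `α` and its complement by `β`. -/
def lineScaling (φ : EuclideanSpace ℂ s) (α β : ℝ) : Matrix s s ℂ :=
  (β : ℂ) • 1 + ((α - β : ℝ) : ℂ) • vecMulVec φ (star φ)

theorem toEuclideanLin_lineScaling (φ x : EuclideanSpace ℂ s) (α β : ℝ) :
    toEuclideanLin (lineScaling φ α β) x =
      (β : ℂ) • x + (((α - β : ℝ) : ℂ) * inner ℂ φ x) • φ := by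
  ext i
  simp [lineScaling, toLpLin_apply, smul_mulVec, vecMulVec_mulVec,
    EuclideanSpace.inner_eq_star_dotProduct, dotProduct_comm]
  ring

theorem norm_sq_lineScaling {φ : EuclideanSpace ℂ s} (hφ : ‖φ‖ = 1) (x : EuclideanSpace ℂ s)
    (α β : ℝ) : ‖toEuclideanLin (lineScaling φ α β) x‖ ^ 2 =
      β ^ 2 * ‖x‖ ^ 2 + (α ^ 2 - β ^ 2) * ‖inner ℂ φ x‖ ^ 2 := by
  rw [toEuclideanLin_lineScaling, @norm_add_sq ℂ, inner_smul_left, inner_smul_right,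
    norm_smul, norm_smul, hφ, ← inner_conj_symm x φ]
  have h : (starRingEnd ℂ) (β : ℂ) * (((α - β : ℝ) : ℂ) * inner ℂ φ x *
      (starRingEnd ℂ) (inner ℂ φ x)) = ((β * (α - β) * ‖inner ℂ φ x‖ ^ 2 : ℝ) : ℂ) := by
    rw [mul_assoc, Complex.mul_conj']
    push_cast
    simp
    ring
  rw [h, norm_mul, Complex.norm_real, Complex.norm_real, mul_one, mul_pow, mul_pow,
    Real.norm_eq_abs, Real.norm_eq_abs, sq_abs, sq_abs]
  simp only [RCLike.re_to_complex, Complex.ofReal_re]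
  ring

theorem det_lineScaling {φ : EuclideanSpace ℂ s} (hφ : ‖φ‖ = 1) (α : ℝ) {β : ℝ} (hβ : β ≠ 0) :
    (lineScaling φ α β).det = (β : ℂ) ^ (Fintype.card s - 1) * α := by
  have hs : 1 ≤ Fintype.card s := by
    rw [Nat.one_le_iff_ne_zero, Ne, Fintype.card_eq_zero_iff]
    intro h
    rw [Subsingleton.elim φ 0, norm_zero] at hφ
    exact zero_ne_one hφ
  have hβ' : (β : ℂ) ≠ 0 := by exact_mod_cast hβ
  have h1 : star φ.ofLp ⬝ᵥ φ.ofLp = 1 := by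
    rw [dotProduct_comm, ← EuclideanSpace.inner_eq_star_dotProduct, inner_self_eq_norm_sq_to_K, hφ]
    simp
  have h : lineScaling φ α β = (β : ℂ) • (1 + replicateCol Unit ((((α - β) / β : ℝ) : ℂ) • φ.ofLp) *
      replicateRow Unit (star φ.ofLp)) := by
    ext i j
    simp [lineScaling, vecMulVec_apply, mul_apply]
    field_simp
  rw [h, det_smul, det_one_add_replicateCol_mul_replicateRow, dotProduct_smul, h1]
  obtain ⟨k, hk⟩ := Nat.exists_eq_add_of_le' hs
  rw [hk, Nat.add_sub_cancel, pow_succ]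
  push_cast
  simp only [smul_eq_mul]
  field_simp
  ring

variable [Fintype b] [DecidableEq b]

theorem slice_kronecker_one (A : Matrix s s ℂ) (z : EuclideanSpace ℂ (s × b)) (k : b) :
    slice (toEuclideanLin (A ⊗ₖ (1 : Matrix b b ℂ)) z) k = toEuclideanLin A (slice z k) := by
  ext i
  simp [slice, toLpLin_apply, mulVec, dotProduct, Fintype.sum_prod_type, kroneckerMap_apply,
    one_apply]

theorem norm_sq_lineScaling_kronecker_one {φ : EuclideanSpace ℂ s} (hφ : ‖φ‖ = 1)
    (z : EuclideanSpace ℂ (s × b)) (α β : ℝ) :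
    ‖toEuclideanLin (lineScaling φ α β ⊗ₖ (1 : Matrix b b ℂ)) z‖ ^ 2 =
      β ^ 2 * ‖z‖ ^ 2 + (α ^ 2 - β ^ 2) * ‖partialInner φ z‖ ^ 2 := by
  rw [← sum_norm_sq_slice, ← sum_norm_sq_slice z, EuclideanSpace.norm_sq_eq, Finset.mul_sum,
    Finset.mul_sum, ← Finset.sum_add_distrib]
  exact Finset.sum_congr rfl fun k _ => by
    rw [slice_kronecker_one, norm_sq_lineScaling hφ, partialInner_apply]

theorem det_restrictScalars_toEuclideanLin {n : Type*} [Fintype n] [DecidableEq n]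
    (A : Matrix n n ℂ) :
    LinearMap.det ((toEuclideanLin A).restrictScalars ℝ) = ‖A.det‖ ^ 2 := by
  rw [LinearMap.det_restrictScalars, LinearMap.det_toLpLin, Algebra.norm_complex_apply,
    Complex.normSq_eq_norm_sq]

theorem one_sub_mul_exp_le {t : ℝ} (h0 : 0 ≤ t) (h1 : t < 1) :
    (1 - t) * Real.exp t ≤ Real.exp (-(t ^ 2 / 2)) := by
  -- Keeps the terms `t + t²/2` of the series of `-log (1 - t)`.
  have h := sum_le_hasSum (Finset.range 2) (fun i _ => by positivity)
    (Real.hasSum_pow_div_log_of_abs_lt_one (by rwa [abs_of_nonneg h0]))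
  norm_num [Finset.sum_range_succ] at h
  calc (1 - t) * Real.exp t = Real.exp (Real.log (1 - t)) * Real.exp t := by
        rw [Real.exp_log (by linarith)]
    _ = Real.exp (Real.log (1 - t) + t) := (Real.exp_add _ _).symm
    _ ≤ _ := Real.exp_le_exp.mpr (by linarith)

theorem pow_one_add_div_le_exp {t : ℝ} (h0 : 0 ≤ t) {k : ℕ} (hk : k ≠ 0) :
    ((k + t) / k) ^ k ≤ Real.exp t := by
  have hk' : (0 : ℝ) < k := by positivity
  calc ((k + t) / k) ^ k ≤ Real.exp (t / k) ^ k := by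
        refine pow_le_pow_left₀ (by positivity) ?_ k
        rw [add_div, div_self hk'.ne', add_comm]
        exact Real.add_one_le_exp _
    _ = Real.exp t := by
        rw [← Real.exp_nat_mul, mul_div_cancel₀ _ hk'.ne']

/-- The vectors `z` of which the component along `φ` is shorter than its mean by a factor
`1 - t`. -/
def deficientCone (t : ℝ) (φ : EuclideanSpace ℂ s) : Set (EuclideanSpace ℂ (s × b)) :=
  {z | Fintype.card s * ‖partialInner φ z‖ ^ 2 ≤ (1 - t) * ‖φ‖ ^ 2 * ‖z‖ ^ 2}

/-- A map that stretches the `φ` component by `α` and shrinks the rest by `β` sends this part of the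
ball back into the ball, so its volume is at most that of the ball divided by the determinant. The
inverse determinant is `((1 - t) (1 + t/k)^k)^{d_B}` with `k = d_S - 1`, and `(1 - t) e^t ≤
e^{-t²/2}` finishes. -/
theorem volume_deficientCone_inter_ball_le {φ : EuclideanSpace ℂ s} (hφ : ‖φ‖ = 1) {t : ℝ}
    (h0 : 0 ≤ t) (h1 : t < 1) (hs : 2 ≤ Fintype.card s) :
    volume (deficientCone (b := b) t φ ∩ Metric.ball 0 1) ≤
      ENNReal.ofReal (Real.exp (-(Fintype.card b * (t ^ 2 / 2)))) *
        volume (Metric.ball (0 : EuclideanSpace ℂ (s × b)) 1) := by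
  obtain ⟨k, hk⟩ := Nat.exists_eq_add_of_le' (show 1 ≤ Fintype.card s by omega)
  have hk0 : k ≠ 0 := by omega
  have hk' : (0 : ℝ) < k := by positivity
  have ht : 0 < 1 - t := by linarith
  -- On the boundary of the cone the two components carry the shares `(1 - t)/(k + 1)` and `(k +
  -- t)/(k + 1)` of `‖z‖²`. These factors rescale them to `1/(k + 1)` and `k/(k + 1)`, so the norm
  -- is unchanged there and does not grow inside.
  set α := √(1 / (1 - t)) with hα
  set β := √(k / (k + t)) with hβ
  have hα2 : α ^ 2 = 1 / (1 - t) := Real.sq_sqrt (by positivity)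
  have hβ2 : β ^ 2 = k / (k + t) := Real.sq_sqrt (by positivity)
  have hα0 : 0 < α := Real.sqrt_pos.mpr (by positivity)
  have hβ0 : 0 < β := Real.sqrt_pos.mpr (by positivity)
  set T := toEuclideanLin (lineScaling φ α β ⊗ₖ (1 : Matrix b b ℂ)) with hT
  have hdet : LinearMap.det (T.restrictScalars ℝ) =
      ((β ^ 2) ^ k * α ^ 2) ^ Fintype.card b := by
    rw [hT, det_restrictScalars_toEuclideanLin, det_kronecker, det_one, one_pow, mul_one,
      det_lineScaling hφ α hβ0.ne', hk, Nat.add_sub_cancel]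
    simp [abs_of_pos hα0, abs_of_pos hβ0]
    ring
  have hsub : deficientCone (b := b) t φ ∩ Metric.ball 0 1 ⊆
      T.restrictScalars ℝ ⁻¹' Metric.ball 0 1 := by
    rintro z ⟨hz, hz1⟩
    simp only [deficientCone, Set.mem_ofPred_eq, hφ, hk] at hz
    simp only [Set.mem_preimage, mem_ball_zero_iff, LinearMap.coe_restrictScalars] at hz1 ⊢
    have hTz : ‖T z‖ ^ 2 ≤ ‖z‖ ^ 2 := by
      rw [hT, norm_sq_lineScaling_kronecker_one hφ, hα2, hβ2]
      have e : 1 / (1 - t) - k / (k + t) = (k + 1) * t / ((1 - t) * (k + t)) := by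
        field_simp
        ring
      have h2 : (k + 1) * t / ((1 - t) * (k + t)) * ‖partialInner φ z‖ ^ 2 ≤
          t / (k + t) * ‖z‖ ^ 2 := by
        push_cast at hz
        calc (k + 1) * t / ((1 - t) * (k + t)) * ‖partialInner φ z‖ ^ 2
            = t / ((1 - t) * (k + t)) * ((k + 1) * ‖partialInner φ z‖ ^ 2) := by ring
          _ ≤ t / ((1 - t) * (k + t)) * ((1 - t) * 1 ^ 2 * ‖z‖ ^ 2) := by gcongr
          _ = t / (k + t) * ‖z‖ ^ 2 := by field_simp
      rw [e]
      have h3 : k / (k + t) * ‖z‖ ^ 2 + t / (k + t) * ‖z‖ ^ 2 = ‖z‖ ^ 2 := by field_simp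
      linarith
    exact (le_of_sq_le_sq hTz (norm_nonneg _)).trans_lt hz1
  refine (measure_mono hsub).trans ?_
  have hpos : 0 < ((β ^ 2) ^ k * α ^ 2) ^ Fintype.card b := by positivity
  rw [Measure.addHaar_preimage_linearMap _ (by rw [hdet]; exact hpos.ne'), hdet,
    abs_of_pos (inv_pos.mpr hpos)]
  gcongr
  rw [← inv_pow, ← mul_neg, Real.exp_nat_mul]
  refine pow_le_pow_left₀ (by positivity) ?_ _
  rw [mul_inv, ← inv_pow, hα2, hβ2, inv_div, inv_div, div_one, mul_comm]
  exact (mul_le_mul_of_nonneg_left (pow_one_add_div_le_exp h0 hk0) ht.le).trans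
    (one_sub_mul_exp_le h0 h1)

end Scaling

/-! ### Haar probabilities of cones as volume ratios -/

section Haar

variable {n : Type*} [Fintype n] [DecidableEq n]

instance unitarySecondCountable : SecondCountableTopology (unitaryGroup n ℂ) :=
  inferInstanceAs (SecondCountableTopology {A : n → n → ℂ // A ∈ unitaryGroup n ℂ})

/-- A right translate is again a left Haar probability measure, and that measure is unique. -/
instance haarUnitary_isMulRightInvariant : (haarUnitary n).IsMulRightInvariant where
  map_mul_right_eq_self g := by
    have : IsProbabilityMeasure ((haarUnitary n).map (· * g)) :=
      Measure.isProbabilityMeasure_map (continuous_mul_const g).aemeasurable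
    exact Measure.isHaarMeasure_eq_of_isProbabilityMeasure _ _

theorem inner_unitary_apply (U : unitaryGroup n ℂ) (x y : EuclideanSpace ℂ n) :
    inner ℂ (toEuclideanLin (U : Matrix n n ℂ) x) (toEuclideanLin (U : Matrix n n ℂ) y) =
      inner ℂ x y := by
  rw [← LinearMap.adjoint_inner_right, ← toEuclideanLin_conjTranspose_eq_adjoint]
  have h : (U : Matrix n n ℂ)ᴴ * (U : Matrix n n ℂ) = 1 := UnitaryGroup.star_mul_self U
  simp only [toLpLin_apply, mulVec_mulVec, h, one_mulVec]

theorem norm_unitary_apply (U : unitaryGroup n ℂ) (x : EuclideanSpace ℂ n) :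
    ‖toEuclideanLin (U : Matrix n n ℂ) x‖ = ‖x‖ := by
  rw [@norm_eq_sqrt_re_inner ℂ, inner_unitary_apply, ← @norm_eq_sqrt_re_inner ℂ]

theorem unitary_mul_apply (U V : unitaryGroup n ℂ) (x : EuclideanSpace ℂ n) :
    toEuclideanLin ((U * V : unitaryGroup n ℂ) : Matrix n n ℂ) x =
      toEuclideanLin (U : Matrix n n ℂ) (toEuclideanLin (V : Matrix n n ℂ) x) := by
  simp [toLpLin_apply, mulVec_mulVec]

theorem continuous_unitary_apply :
    Continuous fun p : unitaryGroup n ℂ × EuclideanSpace ℂ n =>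
      toEuclideanLin (p.1 : Matrix n n ℂ) p.2 := by
  simp only [toLpLin_apply]
  fun_prop

theorem exists_unitary_apply_eq {v w : EuclideanSpace ℂ n} (hv : ‖v‖ = 1) (hw : ‖w‖ = 1) :
    ∃ V : unitaryGroup n ℂ, toEuclideanLin (V : Matrix n n ℂ) v = w := by
  have hn : Nonempty n := by
    by_contra h
    rw [not_nonempty_iff] at h
    rw [Subsingleton.elim v 0, norm_zero] at hv
    exact zero_ne_one hv
  obtain ⟨i⟩ := hn
  have key : ∀ u : EuclideanSpace ℂ n, ‖u‖ = 1 →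
      ∃ b : OrthonormalBasis n ℂ (EuclideanSpace ℂ n), b i = u := by
    intro u hu
    have ho : Orthonormal ℂ (Set.domRestrict {i} fun _ : n => u) :=
      ⟨fun _ => hu, fun a b hab => absurd (Subsingleton.elim a b) hab⟩
    obtain ⟨b, hb⟩ := ho.exists_orthonormalBasis_extension_of_card_eq finrank_euclideanSpace
    exact ⟨b, hb i rfl⟩
  obtain ⟨b, hb⟩ := key v hv
  obtain ⟨c, hc⟩ := key w hw
  let e := EuclideanSpace.basisFun n ℂ
  let f := b.equiv c (Equiv.refl n)
  refine ⟨⟨_, LinearIsometryEquiv.toMatrix_mem_unitaryGroup f e e⟩, ?_⟩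
  rw [toEuclideanLin_eq_toLin_orthonormal, toLin_toMatrix, ← hb, ← hc]
  simp [f]

theorem haarUnitary_apply_mem_eq (K : Set (EuclideanSpace ℂ n)) {v w : EuclideanSpace ℂ n}
    (hv : ‖v‖ = 1) (hw : ‖w‖ = 1) :
    haarUnitary n {U | toEuclideanLin (U : Matrix n n ℂ) w ∈ K} =
      haarUnitary n {U | toEuclideanLin (U : Matrix n n ℂ) v ∈ K} := by
  obtain ⟨V, rfl⟩ := exists_unitary_apply_eq hv hw
  simp only [← unitary_mul_apply]
  exact measure_preimage_mul_right (haarUnitary n) V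
    {U | toEuclideanLin (U : Matrix n n ℂ) v ∈ K}

theorem volume_unitary_preimage (U : unitaryGroup n ℂ) (s : Set (EuclideanSpace ℂ n)) :
    volume (toEuclideanLin (U : Matrix n n ℂ) ⁻¹' s) = volume s := by
  have hdet : LinearMap.det ((toEuclideanLin (U : Matrix n n ℂ)).restrictScalars ℝ) = 1 := by
    have hU : ‖(U : Matrix n n ℂ).det‖ = 1 :=
      CStarRing.norm_of_mem_unitary (E := ℂ) (det_of_mem_unitary U.2)
    rw [det_restrictScalars_toEuclideanLin, hU, one_pow]
  have h := Measure.addHaar_preimage_linearMap (volume : Measure (EuclideanSpace ℂ n))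
    (f := (toEuclideanLin (U : Matrix n n ℂ)).restrictScalars ℝ) (by rw [hdet]; exact one_ne_zero) s
  rw [hdet] at h
  simpa using h

/-- Both sides measure the pairs `(U, z)` with `U z ∈ K` and `z` in the unit ball. For fixed `U`,
unitaries preserve volume and the ball; for fixed `z ≠ 0`, homogeneity and right invariance replace
`z` by `v`. -/
theorem haarUnitary_apply_mem_mul_volume_ball {K : Set (EuclideanSpace ℂ n)}
    (hK : MeasurableSet K) (hcone : ∀ c : ℂ, c ≠ 0 → ∀ z, c • z ∈ K ↔ z ∈ K)
    {v : EuclideanSpace ℂ n} (hv : ‖v‖ = 1) :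
    haarUnitary n {U | toEuclideanLin (U : Matrix n n ℂ) v ∈ K} *
      volume (Metric.ball (0 : EuclideanSpace ℂ n) 1) = volume (K ∩ Metric.ball 0 1) := by
  have : Nontrivial (EuclideanSpace ℂ n) :=
    nontrivial_of_ne v 0 (by rintro rfl; simp at hv)
  set B := Metric.ball (0 : EuclideanSpace ℂ n) 1 with hB
  let S : Set (unitaryGroup n ℂ × EuclideanSpace ℂ n) :=
    {p | toEuclideanLin (p.1 : Matrix n n ℂ) p.2 ∈ K}
  have hS : MeasurableSet S := continuous_unitary_apply.measurable hK
  have h1 := Measure.prod_apply (μ := haarUnitary n) (ν := volume.restrict B) hS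
  rw [Measure.prod_apply_symm hS] at h1
  have h2 : ∀ U : unitaryGroup n ℂ, volume.restrict B (Prod.mk U ⁻¹' S) = volume (K ∩ B) := by
    intro U
    rw [Measure.restrict_apply (measurable_prodMk_left hS), ← volume_unitary_preimage U (K ∩ B)]
    congr 1
    ext z
    simp [S, hB, norm_unitary_apply]
  have h3 : ∀ᵐ z ∂volume.restrict B, haarUnitary n ((fun U => (U, z)) ⁻¹' S) =
      haarUnitary n {U | toEuclideanLin (U : Matrix n n ℂ) v ∈ K} := by
    refine ae_restrict_of_ae ?_
    filter_upwards [compl_mem_ae_iff.mpr (measure_singleton (0 : EuclideanSpace ℂ n))] with z hz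
    have hz : ‖z‖ ≠ 0 := norm_ne_zero_iff.mpr hz
    have hc : ((‖z‖⁻¹ : ℝ) : ℂ) ≠ 0 := by simpa using hz
    rw [← haarUnitary_apply_mem_eq K hv (w := ((‖z‖⁻¹ : ℝ) : ℂ) • z) (by simp [norm_smul, hz])]
    congr 1
    ext U
    simp only [S, Set.mem_preimage, Set.mem_ofPred_eq, map_smul, hcone _ hc]
  rw [lintegral_congr_ae h3, lintegral_congr h2] at h1
  simpa using h1

end Haar

/-! ### Lower tail for a fixed direction -/

section Concentration

variable {s b : Type*} [Fintype s] [Fintype b]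

theorem measurableSet_deficientCone (t : ℝ) (φ : EuclideanSpace ℂ s) :
    MeasurableSet (deficientCone (b := b) t φ) := by
  have h : Continuous fun z : EuclideanSpace ℂ (s × b) => partialInner φ z :=
    continuous_partialInner.comp (by fun_prop : Continuous fun z => (φ, z))
  exact (isClosed_le (by fun_prop) (by fun_prop)).measurableSet

theorem smul_mem_deficientCone_iff (t : ℝ) (φ : EuclideanSpace ℂ s) {c : ℂ} (hc : c ≠ 0)
    (z : EuclideanSpace ℂ (s × b)) : c • z ∈ deficientCone t φ ↔ z ∈ deficientCone t φ := by
  have h : 0 < ‖c‖ ^ 2 := by positivity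
  simp only [deficientCone, Set.mem_ofPred_eq, partialInner_smul_right, norm_smul, mul_pow]
  rw [← mul_le_mul_iff_right₀ h (b := Fintype.card s * ‖partialInner φ z‖ ^ 2)]
  ring_nf

theorem mem_deficientCone_smul_iff (t : ℝ) (φ : EuclideanSpace ℂ s) {c : ℂ} (hc : c ≠ 0)
    (z : EuclideanSpace ℂ (s × b)) : z ∈ deficientCone t (c • φ) ↔ z ∈ deficientCone t φ := by
  have h : 0 < ‖c‖ ^ 2 := by positivity
  simp only [deficientCone, Set.mem_ofPred_eq, partialInner_smul_left, norm_smul, mul_pow,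
    norm_star]
  rw [← mul_le_mul_iff_right₀ h (b := Fintype.card s * ‖partialInner φ z‖ ^ 2)]
  ring_nf

variable [DecidableEq s] [DecidableEq b]

theorem haarUnitary_mem_deficientCone_le {φ : EuclideanSpace ℂ s} (hφ : φ ≠ 0) {t : ℝ}
    (h0 : 0 ≤ t) (h1 : t < 1) (hs : 2 ≤ Fintype.card s) {v : EuclideanSpace ℂ (s × b)}
    (hv : ‖v‖ = 1) :
    haarUnitary (s × b) {U | toEuclideanLin (U : Matrix (s × b) (s × b) ℂ) v ∈ deficientCone t φ} ≤
      ENNReal.ofReal (Real.exp (-(Fintype.card b * (t ^ 2 / 2)))) := by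
  have hφ' : ‖φ‖ ≠ 0 := norm_ne_zero_iff.mpr hφ
  have hc : ((‖φ‖⁻¹ : ℝ) : ℂ) ≠ 0 := by simpa using hφ'
  have hB : volume (Metric.ball (0 : EuclideanSpace ℂ (s × b)) 1) ≠ 0 :=
    (Metric.measure_ball_pos _ _ one_pos).ne'
  rw [← ENNReal.mul_le_mul_iff_left hB measure_ball_lt_top.ne,
    haarUnitary_apply_mem_mul_volume_ball (measurableSet_deficientCone t φ)
      (fun c hc z => smul_mem_deficientCone_iff t φ hc z) hv]
  have h := volume_deficientCone_inter_ball_le (b := b) (φ := ((‖φ‖⁻¹ : ℝ) : ℂ) • φ)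
    (by simp [norm_smul, hφ']) h0 h1 hs
  rwa [Set.ext fun z => mem_deficientCone_smul_iff t φ hc z] at h

end Concentration

/-! ### From trace distance to a deficient direction, and its stability -/

section TraceDistance

theorem trace_abs_re_eq_sum_abs_eigenvalues {n : Type*} [Fintype n] [DecidableEq n]
    {A : Matrix n n ℂ} (hA : A.IsHermitian) :
    (CFC.abs A).trace.re = ∑ i, |hA.eigenvalues i| := by
  rw [CFC.abs_eq_cfc_norm A, hA.cfc_eq, IsHermitian.cfc, Unitary.conjStarAlgAut_apply,
    trace_mul_comm, ← mul_assoc, Unitary.coe_star_mul_self, one_mul, trace_diagonal]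
  simp

theorem exists_quadraticForm_le_of_le_trace_abs {n : Type*} [Fintype n] [DecidableEq n]
    [Nonempty n] {A : Matrix n n ℂ} (hA : A.IsHermitian) (htr : A.trace = 0) {ε : ℝ}
    (hε : ε ≤ (1 / 2) * (CFC.abs A).trace.re) (hε0 : 0 < ε) :
    ∃ φ : EuclideanSpace ℂ n, ‖φ‖ = 1 ∧
      (star φ.ofLp ⬝ᵥ A *ᵥ φ.ofLp).re ≤ -(ε / Fintype.card n) := by
  have hsum : ∑ i, hA.eigenvalues i = 0 := by
    have h := hA.trace_eq_sum_eigenvalues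
    rw [htr] at h
    simpa using congrArg Complex.re h.symm
  have hcard : (0 : ℝ) < Fintype.card n := by exact_mod_cast Fintype.card_pos
  obtain ⟨i, hi⟩ : ∃ i, hA.eigenvalues i ≤ -(ε / Fintype.card n) := by
    by_contra! hcon
    rw [trace_abs_re_eq_sum_abs_eigenvalues hA] at hε
    -- If every eigenvalue exceeds `-ε/n`, then `|λ| < λ + 2ε/n` for each; as the trace vanishes,
    -- the sum of `|λ|` is below `2ε`.
    have hlt : ∑ i, |hA.eigenvalues i| < ∑ i, (hA.eigenvalues i + 2 * (ε / Fintype.card n)) := by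
      refine Finset.sum_lt_sum_of_nonempty Finset.univ_nonempty fun i _ => ?_
      have hpos : 0 < ε / Fintype.card n := by positivity
      rw [abs_lt]
      constructor <;> linarith [hcon i]
    rw [Finset.sum_add_distrib, hsum, Finset.sum_const, Finset.card_univ, nsmul_eq_mul] at hlt
    have h2 : (Fintype.card n : ℝ) * (2 * (ε / Fintype.card n)) = 2 * ε := by field_simp
    linarith
  refine ⟨hA.eigenvectorBasis i, hA.eigenvectorBasis.orthonormal.1 i, ?_⟩
  rw [hA.mulVec_eigenvectorBasis, dotProduct_smul, dotProduct_comm,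
    ← EuclideanSpace.inner_eq_star_dotProduct, inner_self_eq_norm_sq_to_K,
    hA.eigenvectorBasis.orthonormal.1 i]
  simpa using hi

variable {s b : Type*} [Fintype b]

theorem isHermitian_partialTraceB_ketbra (ψ : EuclideanSpace ℂ (s × b)) :
    (partialTraceB (ketbra ψ)).IsHermitian := by
  ext i j
  simp [partialTraceB, ketbra, vecMulVec_apply, mul_comm]

variable [Fintype s]

theorem trace_partialTraceB_ketbra (ψ : EuclideanSpace ℂ (s × b)) :
    (partialTraceB (ketbra ψ)).trace = ((‖ψ‖ ^ 2 : ℝ) : ℂ) := by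
  rw [EuclideanSpace.norm_sq_eq, Fintype.sum_prod_type]
  push_cast
  simp [trace, partialTraceB, ketbra, vecMulVec_apply, ← Complex.mul_conj']

variable (s b) in
/-- The vectors of which the component along some unit vector of the first tensor factor is shorter
than its mean by a factor `1 - ε`. -/
def deficientVectors (ε : ℝ) : Set (EuclideanSpace ℂ (s × b)) :=
  {ψ | ∃ φ : EuclideanSpace ℂ s, ‖φ‖ = 1 ∧ Fintype.card s * ‖partialInner φ ψ‖ ^ 2 ≤ 1 - ε}

theorem smul_mem_deficientVectors {ε : ℝ} {c : ℂ} (hc : ‖c‖ = 1) {ψ : EuclideanSpace ℂ (s × b)}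
    (h : c • ψ ∈ deficientVectors s b ε) : ψ ∈ deficientVectors s b ε := by
  obtain ⟨φ, hφ, hle⟩ := h
  refine ⟨φ, hφ, ?_⟩
  rwa [partialInner_smul_right, norm_smul, hc, one_mul] at hle

theorem mem_deficientVectors_of_le_traceDistance [DecidableEq s] {ψ : EuclideanSpace ℂ (s × b)}
    (hψ : ‖ψ‖ = 1) {ε : ℝ} (hε0 : 0 < ε)
    (hε : ε ≤ traceDistance (partialTraceB (ketbra ψ))
      ((1 / (Fintype.card s : ℂ)) • (1 : Matrix s s ℂ))) :
    ψ ∈ deficientVectors s b ε := by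
  have hs : Nonempty s := by
    by_contra h
    rw [not_nonempty_iff] at h
    rw [Subsingleton.elim ψ 0, norm_zero] at hψ
    exact zero_ne_one hψ
  have hcard : (0 : ℝ) < Fintype.card s := by exact_mod_cast Fintype.card_pos
  have hcard' : (Fintype.card s : ℂ) ≠ 0 := by exact_mod_cast hcard.ne'
  have hA : (partialTraceB (ketbra ψ) - (1 / (Fintype.card s : ℂ)) • (1 : Matrix s s ℂ)).IsHermitian :=
    (isHermitian_partialTraceB_ketbra ψ).sub (by ext i j; simp [one_apply, eq_comm]; aesop)
  have htr : (partialTraceB (ketbra ψ) - (1 / (Fintype.card s : ℂ)) • (1 : Matrix s s ℂ)).trace = 0 := by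
    rw [trace_sub, trace_partialTraceB_ketbra, trace_smul, trace_one, hψ]
    simp [hcard']
  obtain ⟨φ, hφ, hle⟩ := exists_quadraticForm_le_of_le_trace_abs hA htr hε hε0
  refine ⟨φ, hφ, ?_⟩
  have h1 : star φ.ofLp ⬝ᵥ φ.ofLp = 1 := by
    rw [dotProduct_comm, ← EuclideanSpace.inner_eq_star_dotProduct, inner_self_eq_norm_sq_to_K, hφ]
    simp
  rw [sub_mulVec, dotProduct_sub, star_dotProduct_partialTraceB_mulVec, smul_mulVec, one_mulVec,
    dotProduct_smul, h1, Complex.sub_re, Complex.ofReal_re] at hle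
  have h2 : ((1 / (Fintype.card s : ℂ)) • (1 : ℂ)).re = 1 / (Fintype.card s : ℝ) := by
    rw [smul_eq_mul, mul_one, one_div, one_div, ← Complex.ofReal_natCast, ← Complex.ofReal_inv,
      Complex.ofReal_re]
  rw [h2] at hle
  calc Fintype.card s * ‖partialInner φ ψ‖ ^ 2
      ≤ Fintype.card s * (1 / Fintype.card s - ε / Fintype.card s) := by gcongr; linarith
    _ = 1 - ε := by field_simp

theorem norm_partialInner_of_card_eq_one (hs : Fintype.card s = 1) (φ : EuclideanSpace ℂ s)
    (ψ : EuclideanSpace ℂ (s × b)) : ‖partialInner φ ψ‖ = ‖φ‖ * ‖ψ‖ := by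
  obtain ⟨i, hi⟩ := Fintype.card_eq_one_iff.mp hs
  have : Unique s := ⟨⟨i⟩, hi⟩
  rw [← sq_eq_sq₀ (norm_nonneg _) (by positivity), mul_pow, ← sum_norm_sq_slice,
    EuclideanSpace.norm_sq_eq, Finset.mul_sum]
  refine Finset.sum_congr rfl fun k _ => ?_
  rw [partialInner_apply, EuclideanSpace.norm_sq_eq, EuclideanSpace.norm_sq_eq, PiLp.inner_apply]
  simp [mul_pow, mul_comm]

/-- Moving `φ` by `δ = ε/(8 d_S)` raises `d_S ‖⟨φ|ψ⟩‖²` by at most `ε/4 + ε/64` and lowers the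
squared norm by at most `ε/8`; half of the deficiency `ε` absorbs both. The cone is homogeneous in
`χ`, so `χ` need not be normalized. -/
theorem mem_deficientCone_of_near {φ χ : EuclideanSpace ℂ s} (hφ : ‖φ‖ = 1)
    {ψ : EuclideanSpace ℂ (s × b)} (hψ : ‖ψ‖ = 1) {ε : ℝ} (h0 : 0 < ε) (h1 : ε ≤ 1)
    (hs : 2 ≤ Fintype.card s) (hle : Fintype.card s * ‖partialInner φ ψ‖ ^ 2 ≤ 1 - ε)
    (hχ : ‖χ - φ‖ ≤ ε / (8 * Fintype.card s)) : ψ ∈ deficientCone (ε / 2) χ := by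
  simp only [deficientCone, Set.mem_ofPred_eq, hψ]
  have hs' : (2 : ℝ) ≤ Fintype.card s := by exact_mod_cast hs
  set m : ℝ := (Fintype.card s : ℝ)
  set δ := ε / (8 * m) with hδ
  have hδ0 : 0 < δ := by positivity
  have hmδ : m * δ = ε / 8 := by rw [hδ]; field_simp
  have hδ1 : δ ≤ ε / 16 := by nlinarith
  set p := ‖partialInner φ ψ‖
  set r := ‖partialInner χ ψ‖
  have hp : p ≤ 1 := by simpa [hφ, hψ] using norm_partialInner_le φ ψ
  have hr : r ≤ p + δ := by
    have h2 : partialInner χ ψ = partialInner φ ψ + partialInner (χ - φ) ψ := by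
      rw [partialInner_sub]
      abel
    have h3 := norm_partialInner_le (χ - φ) ψ
    rw [hψ, mul_one] at h3
    calc r ≤ p + ‖partialInner (χ - φ) ψ‖ := by
          rw [show r = _ from congrArg norm h2]
          exact norm_add_le _ _
      _ ≤ p + δ := by linarith
  have hr2 : m * r ^ 2 ≤ 1 - ε + ε / 4 + ε / 64 := by
    have h4 : r ^ 2 ≤ p ^ 2 + 2 * δ + δ ^ 2 := by
      have : r ^ 2 ≤ (p + δ) ^ 2 := pow_le_pow_left₀ (norm_nonneg _) hr 2
      nlinarith
    have h5 : m * r ^ 2 ≤ m * p ^ 2 + 2 * (m * δ) + (m * δ) * δ := by nlinarith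
    rw [hmδ] at h5
    nlinarith
  have hχ1 : 1 - δ ≤ ‖χ‖ := by
    have h6 := norm_sub_norm_le φ χ
    rw [norm_sub_rev, hφ] at h6
    linarith
  have hχ2 : 1 - ε / 8 ≤ ‖χ‖ ^ 2 := by nlinarith
  nlinarith

end TraceDistance

/-! ### Uniformity over directions by averaging -/

section Averaging

theorem measurable_unitary_apply {n : Type*} [Fintype n] [DecidableEq n]
    (v : EuclideanSpace ℂ n) :
    Measurable fun U : unitaryGroup n ℂ => toEuclideanLin (U : Matrix n n ℂ) v := by
  have h : Continuous fun U : unitaryGroup n ℂ => toEuclideanLin (U : Matrix n n ℂ) v := by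
    simp only [toLpLin_apply]
    fun_prop
  exact h.measurable

variable {s b : Type*} [Fintype s] [Fintype b]

theorem measurableSet_mem_deficientCone (t : ℝ) :
    MeasurableSet {q : EuclideanSpace ℂ s × EuclideanSpace ℂ (s × b) |
      q.2 ∈ deficientCone t q.1} :=
  (isClosed_le (continuous_const.mul (continuous_partialInner.norm.pow 2))
    ((continuous_const.mul (continuous_fst.norm.pow 2)).mul
      (continuous_snd.norm.pow 2))).measurableSet

variable [DecidableEq s] [DecidableEq b]

theorem haarUnitary_mem_deficientVectors_le (hs : 2 ≤ Fintype.card s) {ε : ℝ} (h0 : 0 < ε)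
    (h1 : ε ≤ 1) {v : EuclideanSpace ℂ (s × b)} (hv : ‖v‖ = 1) :
    haarUnitary (s × b) {U | toEuclideanLin (U : Matrix (s × b) (s × b) ℂ) v ∈
        deficientVectors s b ε} ≤
      ENNReal.ofReal ((1 + 8 * Fintype.card s / ε) ^ (2 * Fintype.card s) *
        Real.exp (-(Fintype.card b * (ε ^ 2 / 8)))) := by
  have hcard : (0 : ℝ) < Fintype.card s := by positivity
  have : Nonempty s := Fintype.card_pos_iff.mp (by omega)
  set δ := ε / (8 * Fintype.card s) with hδ
  have hδ0 : 0 < δ := by positivity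
  set B := Metric.ball (0 : EuclideanSpace ℂ s) (1 + δ)
  set q := Real.exp (-(Fintype.card b * (ε ^ 2 / 8))) with hq
  let S : Set (unitaryGroup (s × b) ℂ × EuclideanSpace ℂ s) :=
    {p | toEuclideanLin (p.1 : Matrix (s × b) (s × b) ℂ) v ∈ deficientCone (ε / 2) p.2}
  have hS : MeasurableSet S := by
    have hg : Measurable fun p : unitaryGroup (s × b) ℂ × EuclideanSpace ℂ s =>
        (p.2, toEuclideanLin (p.1 : Matrix (s × b) (s × b) ℂ) v) :=
      measurable_snd.prodMk ((measurable_unitary_apply v).comp measurable_fst)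
    exact hg (measurableSet_mem_deficientCone (ε / 2))
  let f : unitaryGroup (s × b) ℂ → ENNReal := fun U => volume.restrict B (Prod.mk U ⁻¹' S)
  have hf : Measurable f := measurable_measure_prodMk_left hS
  -- A bad `φ` contributes its full `δ`-ball, which lies in `B`. The superset is measurable, so no
  -- measurability of the bad event is needed.
  have hsub : {U : unitaryGroup (s × b) ℂ | toEuclideanLin (U : Matrix (s × b) (s × b) ℂ) v ∈
      deficientVectors s b ε} ⊆ {U | volume (Metric.ball (0 : EuclideanSpace ℂ s) δ) ≤ f U} := by
    rintro U ⟨φ, hφ, hle⟩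
    rw [Set.mem_ofPred_eq, ← Measure.addHaar_ball_center volume φ]
    refine (measure_mono fun χ hχ => ?_).trans (Measure.le_restrict_apply _ _)
    rw [mem_ball_iff_norm] at hχ
    refine ⟨mem_deficientCone_of_near hφ (by rw [norm_unitary_apply, hv]) h0 h1 hs hle hχ.le, ?_⟩
    rw [mem_ball_zero_iff]
    calc ‖χ‖ = ‖φ + (χ - φ)‖ := by rw [add_sub_cancel]
      _ ≤ ‖φ‖ + ‖χ - φ‖ := norm_add_le _ _
      _ < 1 + δ := by rw [hφ]; linarith
  have hint : ∫⁻ U, f U ∂haarUnitary (s × b) ≤ ENNReal.ofReal q * volume B := by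
    rw [← Measure.prod_apply hS, Measure.prod_apply_symm hS, ← setLIntegral_const]
    refine lintegral_mono_ae (ae_restrict_of_ae ?_)
    filter_upwards [compl_mem_ae_iff.mpr (measure_singleton (0 : EuclideanSpace ℂ s))] with φ hφ
    refine (haarUnitary_mem_deficientCone_le hφ (by positivity) (by linarith) hs hv).trans_eq ?_
    rw [hq]
    ring_nf
  have hmarkov := (mul_meas_ge_le_lintegral hf
    (volume (Metric.ball (0 : EuclideanSpace ℂ s) δ))).trans hint
  refine (measure_mono hsub).trans ?_
  -- The volume ratio is governed by the real dimension `2 d_S`, the source of the exponent in the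
  -- prefactor.
  have hfin : Module.finrank ℝ (EuclideanSpace ℂ s) = 2 * Fintype.card s := by
    rw [← Module.finrank_mul_finrank ℝ ℂ, Complex.finrank_real_complex, finrank_euclideanSpace]
  have hball : volume B = ENNReal.ofReal ((1 + 8 * Fintype.card s / ε) ^ (2 * Fintype.card s)) *
      volume (Metric.ball (0 : EuclideanSpace ℂ s) δ) := by
    have hr : (1 + 8 * Fintype.card s / ε) * δ = 1 + δ := by
      rw [hδ]
      field_simp
      ring
    rw [← hfin, ← Measure.addHaar_ball_mul_of_pos volume 0 (by positivity) δ, hr]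
  have hB0 : volume (Metric.ball (0 : EuclideanSpace ℂ s) δ) ≠ 0 :=
    (Metric.measure_ball_pos _ _ hδ0).ne'
  rw [← ENNReal.mul_le_mul_iff_right hB0 measure_ball_lt_top.ne]
  refine hmarkov.trans_eq ?_
  rw [hball, ENNReal.ofReal_mul (by positivity)]
  ring

end Averaging

/-! ### Eigenvectors and the union bound -/

section Eigenstates

variable {n : Type*}

theorem NondegenerateGaps.injective {E : n → ℝ} (hE : NondegenerateGaps E) :
    Function.Injective E := fun k l h => by
  rcases hE k l l l (by rw [h]) with h | h
  · exact h.1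
  · exact h.1

variable [Fintype n] [DecidableEq n]

/-- By symmetry of `H`, a nonzero coefficient of `ψ` along `f k` forces its eigenvalue to be `E k`;
distinct energies allow only one such `k`. -/
theorem IsEigenstate.exists_eq_smul {H : Matrix n n ℂ} (hH : H.IsHermitian) {E : n → ℝ}
    (hE : Function.Injective E) (f : OrthonormalBasis n ℂ (EuclideanSpace ℂ n))
    (hf : ∀ k, toEuclideanLin H (f k) = (E k : ℂ) • f k) {ψ : EuclideanSpace ℂ n}
    (hψ : IsEigenstate H ψ) : ∃ k, ∃ c : ℂ, ‖c‖ = 1 ∧ ψ = c • f k := by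
  obtain ⟨hnorm, e, he⟩ := hψ
  have key : ∀ k, inner ℂ (f k) ψ ≠ 0 → e = E k := by
    intro k hk
    have h := isSymmetric_toEuclideanLin_iff.mpr hH (f k) ψ
    rw [hf, he.apply_eq_smul, inner_smul_left, inner_smul_right, Complex.conj_ofReal] at h
    exact (mul_right_cancel₀ hk h).symm
  have hsum := f.sum_repr' ψ
  obtain ⟨k, hk⟩ : ∃ k, inner ℂ (f k) ψ ≠ 0 := by
    by_contra! h
    simp only [h, zero_smul, Finset.sum_const_zero] at hsum
    rw [← hsum, norm_zero] at hnorm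
    exact zero_ne_one hnorm
  have hψk : ψ = inner ℂ (f k) ψ • f k := by
    conv_lhs => rw [← hsum]
    refine Finset.sum_eq_single k (fun l _ hl => ?_) (by simp)
    have : inner ℂ (f l) ψ = 0 := by
      by_contra h
      exact hl (hE (by exact_mod_cast (key l h).symm.trans (key k hk)))
    rw [this, zero_smul]
  refine ⟨k, _, ?_, hψk⟩
  have h := congrArg norm hψk
  rwa [norm_smul, f.orthonormal.1 k, mul_one, hnorm, eq_comm] at h

theorem exists_orthonormalBasis_unitary_apply (U : unitaryGroup n ℂ)
    (b : OrthonormalBasis n ℂ (EuclideanSpace ℂ n)) :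
    ∃ f : OrthonormalBasis n ℂ (EuclideanSpace ℂ n),
      ∀ k, f k = toEuclideanLin (U : Matrix n n ℂ) (b k) := by
  have ho : Orthonormal ℂ (Set.domRestrict Set.univ
      fun k => toEuclideanLin (U : Matrix n n ℂ) (b k)) := by
    refine ⟨fun k => ?_, fun k l hkl => ?_⟩
    · exact (norm_unitary_apply U _).trans (b.orthonormal.1 k)
    · exact (inner_unitary_apply U _ _).trans (b.orthonormal.2 (Subtype.coe_injective.ne hkl))
  obtain ⟨f, hf⟩ := ho.exists_orthonormalBasis_extension_of_card_eq finrank_euclideanSpace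
  exact ⟨f, fun k => hf k (Set.mem_univ k)⟩

end Eigenstates

theorem measure_exists_eigenstate_le {s b Ω : Type*} [Fintype s] [Fintype b] [DecidableEq s]
    [DecidableEq b] [MeasurableSpace Ω] {P : Measure Ω}
    {H : Ω → Matrix (s × b) (s × b) ℂ} (hH : IsRandomHamiltonian P H)
    (hs : 2 ≤ Fintype.card s) {ε : ℝ} (h0 : 0 < ε) (h1 : ε ≤ 1) :
    P {ω | ∃ ψ, IsEigenstate (H ω) ψ ∧ ψ ∈ deficientVectors s b ε} ≤
      (Fintype.card (s × b) : ENNReal) *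
        ENNReal.ofReal ((1 + 8 * Fintype.card s / ε) ^ (2 * Fintype.card s) *
          Real.exp (-(Fintype.card b * (ε ^ 2 / 8)))) := by
  obtain ⟨v, U, E, hU, hae⟩ := hH
  calc P {ω | ∃ ψ, IsEigenstate (H ω) ψ ∧ ψ ∈ deficientVectors s b ε}
      ≤ P (⋃ k, U ⁻¹' {V | toEuclideanLin (V : Matrix (s × b) (s × b) ℂ) (v k) ∈
          deficientVectors s b ε}) := by
        refine measure_mono_ae ?_
        filter_upwards [hae] with ω ⟨hherm, hgap, heig⟩
        rintro ⟨ψ, hψ, hbad⟩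
        obtain ⟨f, hf⟩ := exists_orthonormalBasis_unitary_apply (U ω) v
        obtain ⟨k, c, hc, rfl⟩ := hψ.exists_eq_smul hherm hgap.injective f
          (fun k => by rw [hf]; exact (heig k).apply_eq_smul)
        refine Set.mem_iUnion.mpr ⟨k, ?_⟩
        rw [hf] at hbad
        exact smul_mem_deficientVectors hc hbad
    _ ≤ ∑ k, P (U ⁻¹' {V | toEuclideanLin (V : Matrix (s × b) (s × b) ℂ) (v k) ∈
          deficientVectors s b ε}) := measure_iUnion_fintype_le _ _
    _ ≤ ∑ _k : s × b, ENNReal.ofReal ((1 + 8 * Fintype.card s / ε) ^ (2 * Fintype.card s) *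
          Real.exp (-(Fintype.card b * (ε ^ 2 / 8)))) := by
        refine Finset.sum_le_sum fun k _ => ?_
        refine (Measure.le_map_apply hU.aemeasurable _).trans ?_
        rw [hU.map_eq]
        exact haarUnitary_mem_deficientVectors_le hs h0 h1 (v.orthonormal.1 k)
    _ = _ := by rw [Finset.sum_const, Finset.card_univ, nsmul_eq_mul]

end RandomHamiltonian

end

theorem mainTheorem11 (dS dB : ℕ) {Ω : Type*} [MeasurableSpace Ω] (P : Measure Ω)
    [IsProbabilityMeasure P] (H : Ω → Matrix (Fin dS × Fin dB) (Fin dS × Fin dB) ℂ)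
    (hH : RandomHamiltonian.IsRandomHamiltonian P H) (ε : ℝ) (hε : 0 < ε) :
    P.real {ω | ∃ ψ : EuclideanSpace ℂ (Fin dS × Fin dB),
        RandomHamiltonian.IsEigenstate (H ω) ψ ∧
        ε ≤ RandomHamiltonian.traceDistance
          (RandomHamiltonian.partialTraceB (RandomHamiltonian.ketbra ψ))
          ((1 / (dS : ℂ)) • (1 : Matrix (Fin dS) (Fin dS) ℂ))} ≤
      2 * ((dS * dB : ℕ) : ℝ) * (10 * (dS : ℝ) / ε) ^ (2 * dS) *
        Real.exp (-((14 * Real.log 2)⁻¹ * (dB : ℝ) * ε ^ 2)) := by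
  have hsub : {ω | ∃ ψ : EuclideanSpace ℂ (Fin dS × Fin dB),
        RandomHamiltonian.IsEigenstate (H ω) ψ ∧
        ε ≤ RandomHamiltonian.traceDistance
          (RandomHamiltonian.partialTraceB (RandomHamiltonian.ketbra ψ))
          ((1 / (dS : ℂ)) • (1 : Matrix (Fin dS) (Fin dS) ℂ))} ⊆
      {ω | ∃ ψ, RandomHamiltonian.IsEigenstate (H ω) ψ ∧
        ψ ∈ RandomHamiltonian.deficientVectors (Fin dS) (Fin dB) ε} := by
    rintro ω ⟨ψ, hψ, hle⟩
    refine ⟨ψ, hψ, RandomHamiltonian.mem_deficientVectors_of_le_traceDistance hψ.1 hε ?_⟩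
    rwa [Fintype.card_fin]
  -- Otherwise the event is empty: a deficient direction needs `1 - ε ≥ 0`, and for `d_S = 1` the
  -- partial inner product has norm one.
  by_cases hcase : 2 ≤ dS ∧ ε ≤ 1
  · obtain ⟨hs, h1⟩ := hcase
    have hdS : (2 : ℝ) ≤ dS := by exact_mod_cast hs
    have h := (measure_mono hsub).trans
      (RandomHamiltonian.measure_exists_eigenstate_le hH (by simpa using hs) hε h1)
    simp only [Fintype.card_prod, Fintype.card_fin] at h
    rw [← ENNReal.ofReal_natCast, ← ENNReal.ofReal_mul (by positivity)] at h
    refine (ENNReal.toReal_le_of_le_ofReal (by positivity) h).trans ?_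
    have hbase : 1 + 8 * (dS : ℝ) / ε ≤ 10 * dS / ε := by
      rw [← sub_nonneg, show 10 * dS / ε - (1 + 8 * (dS : ℝ) / ε) = (2 * dS - ε) / ε by
        field_simp; ring]
      exact div_nonneg (by linarith) hε.le
    -- The rate `1/8` comes from `t²/2` at `t = ε/2`, and `14 ln 2 > 8`. The factor `2` in the bound
    -- is slack.
    have hC : (14 * Real.log 2)⁻¹ ≤ 1 / 8 := by
      rw [one_div]
      exact inv_anti₀ (by norm_num) (by linarith [Real.log_two_gt_d9])
    have hexp : Real.exp (-(dB * (ε ^ 2 / 8))) ≤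
        Real.exp (-((14 * Real.log 2)⁻¹ * (dB : ℝ) * ε ^ 2)) := by
      refine Real.exp_le_exp.mpr (neg_le_neg ?_)
      calc (14 * Real.log 2)⁻¹ * (dB : ℝ) * ε ^ 2 ≤ 1 / 8 * dB * ε ^ 2 := by gcongr
        _ = dB * (ε ^ 2 / 8) := by ring
    calc ((dS * dB : ℕ) : ℝ) * ((1 + 8 * dS / ε) ^ (2 * dS) * Real.exp (-(dB * (ε ^ 2 / 8))))
        ≤ (2 * ((dS * dB : ℕ) : ℝ)) * ((10 * (dS : ℝ) / ε) ^ (2 * dS) *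
          Real.exp (-((14 * Real.log 2)⁻¹ * (dB : ℝ) * ε ^ 2))) := by
          gcongr
          linarith [(Nat.cast_nonneg (dS * dB) : (0 : ℝ) ≤ ((dS * dB : ℕ) : ℝ))]
      _ = _ := by ring
  · have hempty : {ω | ∃ ψ, RandomHamiltonian.IsEigenstate (H ω) ψ ∧
        ψ ∈ RandomHamiltonian.deficientVectors (Fin dS) (Fin dB) ε} = ∅ := by
      refine Set.eq_empty_of_forall_notMem ?_
      rintro ω ⟨ψ, ⟨hψ, -⟩, φ, hφ, hle⟩
      refine hcase ⟨?_, ?_⟩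
      · by_contra! hlt
        have h1 : Fintype.card (Fin dS) = 1 := by
          rw [Fintype.card_fin]
          have : dS ≠ 0 := by
            rintro rfl
            rw [Subsingleton.elim φ 0, norm_zero] at hφ
            exact zero_ne_one hφ
          omega
        rw [RandomHamiltonian.norm_partialInner_of_card_eq_one h1, h1, hφ, hψ] at hle
        norm_num at hle
        linarith
      · have : 0 ≤ (Fintype.card (Fin dS) : ℝ) *
          ‖RandomHamiltonian.partialInner φ ψ‖ ^ 2 := by positivity
        linarith
    rw [Set.subset_empty_iff.mp (hsub.trans hempty.subset), measureReal_empty]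
    positivity
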